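/- Let $\mathsf{MCart}$ be the full subcategory of the category of topological spaces and continuous maps on the objects that are disjoint unions, indexed by arbitrary sets, of spaces each homeomorphic to some $\mathbf R^n$ ($n\ge 0$; the dimension may vary with the summand). An open cover of $X\in\mathsf{MCart}$ is a family of open embeddings $\{f_i\colon U_i\to X\}_{i\in I}$ in $\mathsf{MCart}$ whose images cover $X$; it is disjoint if the images are pairwise disjoint. In the Grothendieck topology of open covers on $\mathsf{MCart}$, a sieve is covering if and only if it contains an open cover. The Grothendieck topology generated by a collection of families of morphisms is the smallest Grothendieck topology for which each of these families is contained in a covering sieve. **Theorem.** The Grothendieck topology of open covers on $\mathsf{MCart}$ is generated by the following two classes of families: all disjoint open covers (indexed by arbitrary sets) of objects of $\mathsf{MCart}$, and, for every $n\ge 1$, the two-element open cover $\{U,V\}$ of $\mathbf R^n$ by the open subsets $$U=\bigcup_{i\in\mathbf Z}(4i,4i+3)\times\mathbf R^{n-1},\qquad V=\bigcup_{i\in\mathbf Z}(4i+2,4i+5)\times\mathbf R^{n-1}.$$ The same statement holds if topological spaces and continuous maps are replaced by ($C^\infty$, paracompact, Hausdorff) smooth manifolds, whose components may have different dimensions,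 and smooth maps; that is, if $\mathsf{MCart}$ is replaced by the full subcategory of smooth manifolds on the disjoint unions of manifolds each diffeomorphic to some $\mathbf R^n$, with open embeddings being the diffeomorphisms onto open submanifolds. -/

import Mathlib

open CategoryTheory Set Topology
open scoped ContDiff

universe u

namespace CartSite

/-- `ℝⁿ`, with its Euclidean topology and smooth structure. -/
abbrev E (n : ℕ) : Type := EuclideanSpace ℝ (Fin n)

/-- `ℝⁿ` as a topological space in the universe `u`. -/
abbrev EU (n : ℕ) : Type u := ULift.{u} (E n)

/-- `U = ⋃_{i ∈ ℤ} (4i, 4i+3) × ℝⁿ`, a subset of `ℝⁿ⁺¹`. -/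
def stdU (n : ℕ) : Set (E (n + 1)) :=
  ⋃ i : ℤ, {v | v 0 ∈ Ioo (4 * i : ℝ) (4 * i + 3)}

/-- `V = ⋃_{i ∈ ℤ} (4i+2, 4i+5) × ℝⁿ`, a subset of `ℝⁿ⁺¹`. -/
def stdV (n : ℕ) : Set (E (n + 1)) :=
  ⋃ i : ℤ, {v | v 0 ∈ Ioo (4 * i + 2 : ℝ) (4 * i + 5)}

/-! ### Open covers in a category of spaces

`F : C ⥤ TopCat` is the underlying space functor of a category of spaces and `P` its class of open
embeddings. -/

section Covers

variable {C : Type (u + 1)} [Category.{u} C] (F : C ⥤ TopCat.{u}) (P : MorphismProperty C)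

/-- An open cover of `X`: a jointly surjective family of open embeddings into `X`. -/
def IsOpenCover {X : C} {I : Type*} {Y : I → C} (f : ∀ i, Y i ⟶ X) : Prop :=
  (∀ i, P (f i)) ∧ ⋃ i, range (F.map (f i)) = univ

/-- A disjoint open cover: the elements of the cover are pairwise disjoint. -/
def IsDisjointOpenCover {X : C} {I : Type*} {Y : I → C} (f : ∀ i, Y i ⟶ X) : Prop :=
  IsOpenCover F P f ∧ Pairwise fun i j => Disjoint (range (F.map (f i))) (range (F.map (f j)))

/-- A sieve on `X` is covering for the topology of open covers if it contains an open cover. -/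
def ContainsOpenCover {X : C} (S : Sieve X) : Prop :=
  ∃ (I : Type u) (Y : I → C) (f : ∀ i, Y i ⟶ X), IsOpenCover F P f ∧ ∀ i, S (f i)

theorem containsOpenCover_iff {X : C} {S : Sieve X} :
    ContainsOpenCover F P S ↔
      ∀ x : F.obj X, ∃ (Y : C) (f : Y ⟶ X), P f ∧ S f ∧ x ∈ range (F.map f) := by
  constructor
  · rintro ⟨I, Y, f, ⟨hP, hc⟩, hS⟩ x
    have hx : x ∈ ⋃ i, range (F.map (f i)) := hc ▸ mem_univ x
    obtain ⟨i, hi⟩ := mem_iUnion.1 hx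
    exact ⟨Y i, f i, hP i, hS i, hi⟩
  · intro h
    choose Y f hP hS hx using h
    exact ⟨F.obj X, Y, f, ⟨hP, eq_univ_of_forall fun x => mem_iUnion.2 ⟨x, hx x⟩⟩, hS⟩

/-- The Grothendieck topology of open covers: the covering sieves are those that contain an open
cover. This is a topology as soon as open embeddings compose and open covers form a coverage, which
is the condition `hloc`. -/
def openCoverTopology [P.IsMultiplicative]
    (hloc : ∀ {X Y U : C} (g : Y ⟶ X) (f : U ⟶ X), P f → ∀ y : F.obj Y,
      F.map g y ∈ range (F.map f) →
        ∃ (W : C) (h : W ⟶ Y) (k : W ⟶ U), P h ∧ y ∈ range (F.map h) ∧ h ≫ g = k ≫ f) :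
    GrothendieckTopology C where
  sieves _ := {S | ContainsOpenCover F P S}
  top_mem' X := (containsOpenCover_iff F P).2 fun x =>
    ⟨X, 𝟙 X, P.id_mem X, trivial, x, by simp⟩
  pullback_stable' := by
    intro X Y S g hS
    refine (containsOpenCover_iff F P).2 fun y => ?_
    obtain ⟨U, f, hf, hSf, hx⟩ := (containsOpenCover_iff F P).1 hS (F.map g y)
    obtain ⟨W, h, k, hh, hy, e⟩ := hloc g f hf y hx
    refine ⟨W, h, hh, ?_, hy⟩
    rw [Sieve.pullback_apply, e]
    exact S.downward_closed hSf k
  transitive' := by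
    intro X S hS R hR
    refine (containsOpenCover_iff F P).2 fun x => ?_
    obtain ⟨U, f, hf, hSf, u, rfl⟩ := (containsOpenCover_iff F P).1 hS x
    obtain ⟨W, h, hh, hRh, w, rfl⟩ := (containsOpenCover_iff F P).1 (hR hSf) u
    exact ⟨W, h ≫ f, P.comp_mem _ _ hh hf, hRh, w, by simp⟩

/-- The two classes of generating covers. Here `R n` is the object `ℝⁿ` of `C` and `coord n` are its
coordinates. An open subset is given, as an object over the ambient space, by an open embedding with
that image; it is unique up to a unique isomorphism. -/
inductive IsGenerator (R : ℕ → C) (coord : ∀ n, F.obj (R n) → E n) :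
    ∀ {X : C}, Presieve X → Prop
  /-- Disjoint open covers, indexed by arbitrary sets. -/
  | disjoint {X : C} {I : Type u} {Y : I → C} (f : ∀ i, Y i ⟶ X)
      (hf : IsDisjointOpenCover F P f) : IsGenerator R coord (Presieve.ofArrows Y f)
  /-- The cover `{U, V}` of a cartesian space of positive dimension. -/
  | two (n : ℕ) {Y : Fin 2 → C} (f : ∀ i, Y i ⟶ R (n + 1)) (hf : ∀ i, P (f i))
      (hU : range (F.map (f 0)) = coord (n + 1) ⁻¹' stdU n)
      (hV : range (F.map (f 1)) = coord (n + 1) ⁻¹' stdV n) :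
      IsGenerator R coord (Presieve.ofArrows Y f)

/-- The collection of all generating covers. -/
def generators (R : ℕ → C) (coord : ∀ n, F.obj (R n) → E n) : Precoverage C where
  coverings _ := {S | IsGenerator F P R coord S}

end Covers

/-! ### The topological site -/

/-- `X` is a disjoint union of spaces each homeomorphic to some `ℝⁿ`. -/
def isMCart : ObjectProperty TopCat.{u} := fun X =>
  ∃ (I : Type u) (n : I → ℕ), Nonempty (X ≃ₜ Σ i, E (n i))

/-- Disjoint unions of cartesian spaces and continuous maps, as a full subcategory of spaces. -/
abbrev MCart : Type (u + 1) := isMCart.{u}.FullSubcategory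

namespace MCart

/-- Open embeddings. -/
def openEmb : MorphismProperty MCart.{u} := fun _ _ f => IsOpenEmbedding (isMCart.ι.map f)

instance : openEmb.{u}.IsMultiplicative where
  id_mem _ := IsOpenEmbedding.id
  comp_mem f g hf hg := by
    simpa [openEmb] using IsOpenEmbedding.comp (g := isMCart.ι.map g) hg hf

/-- The object `ℝⁿ`. -/
def space (n : ℕ) : MCart.{u} where
  obj := TopCat.of (EU.{u} n)
  property := ⟨PUnit, fun _ => n, ⟨Homeomorph.ulift.trans
    { toFun := fun v => ⟨⟨⟩, v⟩
      invFun := fun p => p.2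
      continuous_toFun := continuous_sigmaMk (σ := fun _ : PUnit => E n) (i := ⟨⟩)
      continuous_invFun := continuous_sigma fun _ => continuous_id }⟩⟩

theorem exists_local {X Y U : MCart.{u}} (g : Y ⟶ X) (f : U ⟶ X) (hf : openEmb f)
    (y : isMCart.ι.obj Y) (hy : isMCart.ι.map g y ∈ range (isMCart.ι.map f)) :
    ∃ (W : MCart.{u}) (h : W ⟶ Y) (k : W ⟶ U),
      openEmb h ∧ y ∈ range (isMCart.ι.map h) ∧ h ≫ g = k ≫ f := by
  obtain ⟨I, n, ⟨φ⟩⟩ := Y.property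
  obtain ⟨⟨i, v⟩, rfl⟩ := φ.symm.surjective y
  let q : E (n i) → Y.obj := fun w => φ.symm ⟨i, w⟩
  have hq : IsOpenEmbedding q := φ.symm.isOpenEmbedding.comp IsOpenEmbedding.sigmaMk
  have hO : IsOpen {w | g.hom (q w) ∈ range f.hom} :=
    hf.isOpen_range.preimage (g.hom.hom.continuous.comp hq.continuous)
  obtain ⟨r, hr, hball⟩ := Metric.isOpen_iff.1 hO v hy
  let b := OpenPartialHomeomorph.univBall v r
  have hb : IsOpenEmbedding b := b.isOpenEmbedding (OpenPartialHomeomorph.univBall_source v r)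
  let h : space (n i) ⟶ Y := ⟨TopCat.ofHom (X := EU.{u} (n i)) ⟨fun w => q (b w.down),
    hq.continuous.comp (hb.continuous.comp continuous_uliftDown)⟩⟩
  have hmem : ∀ w : (space.{u} (n i)).obj, g.hom (h.hom w) ∈ range f.hom := fun w => hball <| by
    rw [← OpenPartialHomeomorph.univBall_target v hr]
    exact b.map_source (by simp [b])
  choose k hk using hmem
  refine ⟨_, h, ⟨TopCat.ofHom ⟨k, ?_⟩⟩, ?_, ?_, ?_⟩
  · refine hf.isInducing.continuous_iff.2 ?_
    exact (g.hom.hom.continuous.comp h.hom.hom.continuous).congr fun w => (hk w).symm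
  · exact hq.comp (hb.comp Homeomorph.ulift.isOpenEmbedding)
  · exact ⟨(⟨0⟩ : EU.{u} (n i)), congrArg q (OpenPartialHomeomorph.univBall_apply_zero v r)⟩
  · ext w
    exact (hk w).symm

/-- The Grothendieck topology of open covers. -/
def openCovers : GrothendieckTopology MCart.{u} :=
  openCoverTopology isMCart.ι openEmb exists_local

/-- The Grothendieck topology generated by disjoint open covers and the covers `{U, V}`. -/
def generated : GrothendieckTopology MCart.{u} :=
  (generators isMCart.ι openEmb space fun n (v : EU.{u} n) => v.down).toGrothendieck

end MCart

/-! ### The smooth site -/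

/-- A smooth manifold (paracompact and Hausdorff), given by an atlas. Its components may have
different dimensions, so that a chart comes with its dimension. -/
structure SmoothManifold : Type (u + 1) where
  carrier : Type u
  [top : TopologicalSpace carrier]
  [t2 : T2Space carrier]
  [paracompact : ParacompactSpace carrier]
  atlas : Set (Σ n, OpenPartialHomeomorph carrier (E n))
  cover : ∀ x, ∃ e ∈ atlas, x ∈ e.2.source
  compatible : ∀ e ∈ atlas, ∀ e' ∈ atlas,
    ContDiffOn ℝ ∞ (e'.2 ∘ e.2.symm) (e.2.target ∩ e.2.symm ⁻¹' e'.2.source)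

namespace SmoothManifold

attribute [instance] top t2 paracompact

/-- `f` is smooth on the (open) set `s`: it is continuous there, and smooth in charts. -/
def SmoothOn {M N : SmoothManifold.{u}} (f : M.carrier → N.carrier) (s : Set M.carrier) : Prop :=
  ContinuousOn f s ∧ ∀ e ∈ M.atlas, ∀ e' ∈ N.atlas,
    ContDiffOn ℝ ∞ (e'.2 ∘ f ∘ e.2.symm) (e.2.target ∩ e.2.symm ⁻¹' (s ∩ f ⁻¹' e'.2.source))

/-- A smooth map between smooth manifolds. -/
@[ext]
structure Hom (M N : SmoothManifold.{u}) : Type u where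
  toFun : M.carrier → N.carrier
  smooth : SmoothOn toFun univ

theorem smoothOn_id {M : SmoothManifold.{u}} : SmoothOn (id : M.carrier → M.carrier) univ :=
  ⟨continuousOn_id, fun e he e' he' => by simpa using M.compatible e he e' he'⟩

theorem SmoothOn.congr {M N : SmoothManifold.{u}} {f g : M.carrier → N.carrier}
    {s : Set M.carrier} (hf : SmoothOn f s) (h : EqOn g f s) : SmoothOn g s := by
  refine ⟨hf.1.congr h, fun e he e' he' => ?_⟩
  have hs : s ∩ g ⁻¹' e'.2.source = s ∩ f ⁻¹' e'.2.source := by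
    ext x
    simp only [mem_inter_iff, mem_preimage]
    exact and_congr_right fun hx => by rw [h hx]
  rw [hs]
  exact (hf.2 e he e' he').congr fun p hp => congrArg e'.2 (h hp.2.1)

theorem SmoothOn.mono {M N : SmoothManifold.{u}} {f : M.carrier → N.carrier}
    {s t : Set M.carrier} (hf : SmoothOn f s) (h : t ⊆ s) : SmoothOn f t :=
  ⟨hf.1.mono h, fun e he e' he' => (hf.2 e he e' he').mono fun _ hp => ⟨hp.1, h hp.2.1, hp.2.2⟩⟩

theorem SmoothOn.comp {M N K : SmoothManifold.{u}} {g : N.carrier → K.carrier}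
    {f : M.carrier → N.carrier} {s : Set M.carrier} {t : Set N.carrier} (hg : SmoothOn g t)
    (hf : SmoothOn f s) (h : MapsTo f s t) : SmoothOn (g ∘ f) s := by
  refine ⟨hg.1.comp hf.1 h, fun e he e'' he'' p hp => ?_⟩
  obtain ⟨e', he', hx⟩ := N.cover (f (e.2.symm p))
  have hc : ContinuousWithinAt (f ∘ e.2.symm)
      (e.2.target ∩ e.2.symm ⁻¹' (s ∩ (g ∘ f) ⁻¹' e''.2.source)) p :=
    (hf.1.comp (e.2.continuousOn_symm.mono inter_subset_left) fun _ hz => hz.2.1) p hp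
  have hB := hc.preimage_mem_nhdsWithin (e'.2.open_source.mem_nhds hx)
  rw [← contDiffWithinAt_inter' hB]
  have h1 := hf.2 e he e' he' p ⟨hp.1, hp.2.1, hx⟩
  have h2 := hg.2 e' he' e'' he'' (e'.2 (f (e.2.symm p)))
    ⟨e'.2.map_source hx, by
      rw [mem_preimage, e'.2.left_inv hx]; exact ⟨h hp.2.1, hp.2.2⟩⟩
  have h3 := h2.comp p (h1.mono (s := _)
    (t := e.2.target ∩ e.2.symm ⁻¹' (s ∩ (g ∘ f) ⁻¹' e''.2.source) ∩
      (f ∘ e.2.symm) ⁻¹' e'.2.source) fun z hz => ⟨hz.1.1, hz.1.2.1, hz.2⟩) (by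
    rintro z ⟨hz, hz'⟩
    exact ⟨e'.2.map_source hz', by
      have hl : e'.2.symm ((e'.2 ∘ f ∘ e.2.symm) z) = f (e.2.symm z) := e'.2.left_inv hz'
      rw [mem_preimage, hl]; exact ⟨h hz.2.1, hz.2.2⟩⟩)
  refine h3.congr (fun z hz => ?_) ?_
  · exact congrArg (fun y => e''.2 (g y)) (e'.2.left_inv hz.2).symm
  · exact congrArg (fun y => e''.2 (g y)) (e'.2.left_inv hx).symm

instance : Category.{u} SmoothManifold.{u} where
  Hom := Hom
  id M := ⟨id, smoothOn_id⟩
  comp f g := ⟨g.toFun ∘ f.toFun, g.smooth.comp f.smooth (mapsTo_univ _ _)⟩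

/-- The underlying topological space. -/
def forgetTop : SmoothManifold.{u} ⥤ TopCat.{u} where
  obj M := TopCat.of M.carrier
  map f := TopCat.ofHom ⟨f.toFun, continuousOn_univ.1 f.smooth.1⟩

/-- Open embeddings: topological open embeddings whose inverse is smooth on the image. -/
def openEmb : MorphismProperty SmoothManifold.{u} := fun M N f =>
  IsOpenEmbedding (f : Hom M N).toFun ∧
    ∀ g : N.carrier → M.carrier, Function.LeftInverse g (f : Hom M N).toFun →
      SmoothOn g (range (f : Hom M N).toFun)

instance : openEmb.{u}.IsMultiplicative where
  id_mem M := ⟨IsOpenEmbedding.id, fun g hg =>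
    (smoothOn_id.mono (subset_univ _)).congr fun x _ => hg x⟩
  comp_mem {M N K} f g hf hg := by
    refine ⟨hg.1.comp hf.1, fun q hq => ?_⟩
    rcases isEmpty_or_nonempty M.carrier with hM | hM
    · refine ⟨fun x hx => (hM.false (q x)).elim, fun e _ e' _ p _ => (hM.false (q (e.2.symm p))).elim⟩
    have : Nonempty N.carrier := hM.map (f : Hom M N).toFun
    have hf' := hf.2 _ (Function.leftInverse_invFun hf.1.injective)
    have hg' := hg.2 _ (Function.leftInverse_invFun hg.1.injective)
    have hsub : range (f ≫ g : Hom M K).toFun ⊆ range (g : Hom N K).toFun :=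
      range_comp_subset_range (f : Hom M N).toFun (g : Hom N K).toFun
    refine (hf'.comp (hg'.mono hsub) ?_).congr ?_
    · rintro _ ⟨x, rfl⟩
      exact ⟨x, (Function.leftInverse_invFun hg.1.injective _).symm⟩
    · rintro _ ⟨x, rfl⟩
      refine (hq x).trans ?_
      change x = Function.invFun (f : Hom M N).toFun (Function.invFun (g : Hom N K).toFun
        ((g : Hom N K).toFun ((f : Hom M N).toFun x)))
      rw [Function.leftInverse_invFun hg.1.injective, Function.leftInverse_invFun hf.1.injective]

/-- The smooth manifold `ℝⁿ`. -/
def space (n : ℕ) : SmoothManifold.{u} where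
  carrier := EU.{u} n
  paracompact := Homeomorph.ulift.isClosedEmbedding.paracompactSpace
  atlas := {⟨n, Homeomorph.ulift.toOpenPartialHomeomorph⟩}
  cover x := ⟨_, rfl, mem_univ x⟩
  compatible := by
    rintro _ rfl _ rfl
    exact contDiffOn_id

/-- The open embedding of `ℝⁿ` into itself as a ball. -/
theorem exists_ball (n : ℕ) (v : E n) (r : ℝ) (hr : 0 < r) :
    ∃ b : space.{u} n ⟶ space n, openEmb b ∧
      (b : Hom _ _).toFun ⟨0⟩ = ⟨v⟩ ∧
      ∀ w, ((b : Hom _ _).toFun w : EU.{u} n).down ∈ Metric.ball v r := by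
  let b := OpenPartialHomeomorph.univBall v r
  have hb : IsOpenEmbedding b := b.isOpenEmbedding (OpenPartialHomeomorph.univBall_source v r)
  let B : EU.{u} n → EU.{u} n := fun w => ⟨b w.down⟩
  have hB : IsOpenEmbedding B := Homeomorph.ulift.symm.isOpenEmbedding.comp
    (hb.comp Homeomorph.ulift.isOpenEmbedding)
  have hs : SmoothOn (M := space n) (N := space n) B univ := by
    refine ⟨hB.continuous.continuousOn, ?_⟩
    rintro _ rfl _ rfl
    exact OpenPartialHomeomorph.contDiff_univBall.contDiffOn
  have hmem : ∀ w, b w ∈ Metric.ball v r := fun w => by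
    rw [← OpenPartialHomeomorph.univBall_target v hr]
    exact b.map_source (by simp [b])
  refine ⟨⟨B, hs⟩, ⟨hB, fun g hg => ?_⟩,
    congrArg ULift.up (OpenPartialHomeomorph.univBall_apply_zero v r), fun w => hmem _⟩
  have hG : SmoothOn (M := space n) (N := space n) (fun w : EU.{u} n => ⟨b.symm w.down⟩)
      (range B) := by
    constructor
    · refine continuous_uliftUp.comp_continuousOn ?_
      refine (OpenPartialHomeomorph.continuousOn_univBall_symm v r).comp
        continuous_uliftDown.continuousOn ?_
      rintro _ ⟨w, rfl⟩
      exact hmem _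
    · rintro _ rfl _ rfl
      refine OpenPartialHomeomorph.contDiffOn_univBall_symm.mono ?_
      rintro p ⟨-, ⟨w, hw⟩, -⟩
      have : p = b w.down := (congrArg ULift.down hw).symm
      exact this ▸ hmem _
  refine hG.congr ?_
  rintro _ ⟨w, rfl⟩
  refine (hg w).trans ?_
  exact congrArg ULift.up (b.left_inv (by simp [b])).symm

end SmoothManifold

/-- `M` is a disjoint union of open submanifolds each diffeomorphic to some `ℝⁿ`. -/
def isSmoothMCart : ObjectProperty SmoothManifold.{u} := fun M =>
  ∃ (I : Type u) (n : I → ℕ) (f : ∀ i, SmoothManifold.space (n i) ⟶ M),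
    IsDisjointOpenCover SmoothManifold.forgetTop SmoothManifold.openEmb f

/-- Disjoint unions of cartesian spaces and smooth maps, as a full subcategory of smooth
manifolds. -/
abbrev SmoothMCart : Type (u + 1) := isSmoothMCart.{u}.FullSubcategory

namespace SmoothMCart

/-- The underlying topological space. -/
def forgetTop : SmoothMCart.{u} ⥤ TopCat.{u} := isSmoothMCart.ι ⋙ SmoothManifold.forgetTop

/-- Open embeddings: diffeomorphisms onto open submanifolds. -/
def openEmb : MorphismProperty SmoothMCart.{u} :=
  SmoothManifold.openEmb.inverseImage isSmoothMCart.ι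

instance : openEmb.{u}.IsMultiplicative :=
  inferInstanceAs (SmoothManifold.openEmb.inverseImage isSmoothMCart.ι).IsMultiplicative

/-- The object `ℝⁿ`. -/
def space (n : ℕ) : SmoothMCart.{u} where
  obj := SmoothManifold.space n
  property := ⟨PUnit, fun _ => n, fun _ => 𝟙 _, ⟨fun _ => MorphismProperty.id_mem _ _,
    eq_univ_of_forall fun x => mem_iUnion.2 ⟨⟨⟩, x, by simp⟩⟩,
    fun i j h => (h (Subsingleton.elim i j)).elim⟩

theorem exists_local {X Y U : SmoothMCart.{u}} (g : Y ⟶ X) (f : U ⟶ X) (hf : openEmb f)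
    (y : forgetTop.obj Y) (hy : forgetTop.map g y ∈ range (forgetTop.map f)) :
    ∃ (W : SmoothMCart.{u}) (h : W ⟶ Y) (k : W ⟶ U),
      openEmb h ∧ y ∈ range (forgetTop.map h) ∧ h ≫ g = k ≫ f := by
  obtain ⟨I, n, φ, ⟨hφ, hcov⟩, -⟩ := Y.property
  have hy' : y ∈ ⋃ i, range (SmoothManifold.forgetTop.map (φ i)) := hcov ▸ mem_univ y
  obtain ⟨i, v, rfl⟩ := mem_iUnion.1 hy'
  let q : SmoothManifold.Hom (SmoothManifold.space (n i)) Y.obj := φ i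
  let g' : SmoothManifold.Hom Y.obj X.obj := g.hom
  let f' : SmoothManifold.Hom U.obj X.obj := f.hom
  have hO : IsOpen {w : E (n i) | g'.toFun (q.toFun ⟨w⟩) ∈ range f'.toFun} :=
    hf.1.isOpen_range.preimage ((continuousOn_univ.1 g'.smooth.1).comp
      ((hφ i).1.continuous.comp continuous_uliftUp))
  obtain ⟨r, hr, hball⟩ := Metric.isOpen_iff.1 hO v.down hy
  obtain ⟨b, hb, hb0, hbr⟩ := SmoothManifold.exists_ball.{u} (n i) v.down r hr
  let h : space (n i) ⟶ Y := ⟨b ≫ φ i⟩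
  let h' : SmoothManifold.Hom (SmoothManifold.space (n i)) Y.obj := h.hom
  have hmem : ∀ w, g'.toFun (h'.toFun w) ∈ range f'.toFun := fun w => hball (hbr w)
  obtain ⟨u₀, -⟩ := hmem ⟨0⟩
  have : Nonempty U.obj.carrier := ⟨u₀⟩
  have : Nonempty (isSmoothMCart.ι.obj U).carrier := this
  have hinv := Function.leftInverse_invFun hf.1.injective
  have hk : SmoothManifold.SmoothOn (Function.invFun f'.toFun ∘ (g'.toFun ∘ h'.toFun)) univ :=
    (hf.2 _ hinv).comp (g'.smooth.comp h'.smooth (mapsTo_univ _ _)) fun w _ => hmem w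
  refine ⟨_, h, ⟨⟨_, hk⟩⟩, SmoothManifold.openEmb.comp_mem _ _ hb (hφ i), ⟨⟨0⟩, ?_⟩, ?_⟩
  · exact congrArg q.toFun hb0
  · refine ObjectProperty.hom_ext _ (SmoothManifold.Hom.ext (funext fun w => ?_))
    obtain ⟨x, hx⟩ := hmem w
    change g'.toFun (h'.toFun w) = f'.toFun (Function.invFun f'.toFun (g'.toFun (h'.toFun w)))
    rw [← hx]
    exact congrArg f'.toFun (hinv x).symm

/-- The Grothendieck topology of open covers. -/
def openCovers : GrothendieckTopology SmoothMCart.{u} :=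
  openCoverTopology forgetTop openEmb exists_local

/-- The Grothendieck topology generated by disjoint open covers and the covers `{U, V}`. -/
def generated : GrothendieckTopology SmoothMCart.{u} :=
  (generators forgetTop openEmb space fun n (v : EU.{u} n) => v.down).toGrothendieck

end SmoothMCart

end CartSite

/-!
Each generating family is an open cover, so the generated topology `T` is contained in the topology
of open covers. For the converse, let `S` be a sieve that contains an open cover. Both sites share a
few properties (`IsCartesianSite`) from which `S ∈ T` follows.

* For every morphism `f` to the line, the sieve of all morphisms after which `f` takes its values in
  some open interval of length `3` belongs to `T` (`IsCartesianSite.intervalSieve_mem`): the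
  generating cover `{U, V}` of the line, pulled back along `f`, makes `f` take its values in `U` or
  in `V`, and a disjoint cover of the source by cartesian spaces, which are connected, makes each
  piece land in a single component of `U` or `V`.
* Since every object is disjointly covered by cartesian spaces, `S` may be taken to be a sieve on
  `ℝⁿ`. The previous point, applied to `‖x‖²`, localizes the problem to morphisms with bounded
  image. On a bounded set the open cover has a Lebesgue number, and the previous point, applied to
  suitable multiples of the `n` coordinates, localizes further to morphisms whose image lies in a
  cube so small that it is contained in a member of the cover. Such a morphism factors through that
  member, hence belongs to `S` (`IsCartesianSite.mem_generated_of_containsOpenCover_space`).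

All functions used are smooth, so the argument applies to both sites. What has to be constructed in
each is an object that represents the union of intervals `U` or `V`, namely a countable disjoint
union of lines embedded in the line by `intervalsMap`.
-/

namespace CartSite

/-! ### Subsets of the real line and Lebesgue numbers -/

/-- A connected subset of `⋃ i, (4i + c, 4i + c + 3)` lies in a single one of these intervals. -/
theorem exists_subset_Ioo_of_isPreconnected {s : Set ℝ} (hs : _root_.IsPreconnected s) (c : ℝ)
    (h : s ⊆ ⋃ i : ℤ, Ioo (4 * i + c) (4 * i + c + 3)) :
    ∃ a : ℝ, s ⊆ Ioo a (a + 3) := by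
  rcases s.eq_empty_or_nonempty with rfl | ⟨p, hp⟩
  · exact ⟨0, empty_subset _⟩
  obtain ⟨i, hi₁, hi₂⟩ := mem_iUnion.1 (h hp)
  -- a connected set leaves the interval around `p` through an endpoint, but no endpoint is in
  -- the union
  have hleft : 4 * i + c ∉ s := fun hm => by
    obtain ⟨j, hj₁, hj₂⟩ := mem_iUnion.1 (h hm)
    have h₁ : 4 * j < 4 * i := by exact_mod_cast (by linarith : (4 * j : ℝ) < 4 * i)
    have h₂ : 4 * i < 4 * j + 3 := by exact_mod_cast (by linarith : (4 * i : ℝ) < 4 * j + 3)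
    omega
  have hright : 4 * i + c + 3 ∉ s := fun hm => by
    obtain ⟨j, hj₁, hj₂⟩ := mem_iUnion.1 (h hm)
    have h₁ : 4 * j < 4 * i + 3 := by exact_mod_cast (by linarith : (4 * j : ℝ) < 4 * i + 3)
    have h₂ : 4 * i + 3 < 4 * j + 3 := by
      exact_mod_cast (by linarith : (4 * i + 3 : ℝ) < 4 * j + 3)
    omega
  refine ⟨4 * i + c, fun q hq => ⟨?_, ?_⟩⟩ <;> by_contra! hlt
  · exact hleft (hs.ordConnected.out hq hp ⟨hlt, hi₁.le⟩)
  · exact hright (hs.ordConnected.out hp hq ⟨hi₂.le, hlt⟩)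

/-- Lebesgue's number lemma, with cubes in place of balls. -/
theorem exists_cube_subset_of_isCompact {n : ℕ} {K : Set (E n)} (hK : IsCompact K) {ι : Type*}
    {c : ι → Set (E n)} (hc : ∀ i, IsOpen (c i)) (hKc : K ⊆ ⋃ i, c i) :
    ∃ ε > 0, ∀ x ∈ K, ∃ i, ∀ y : E n, (∀ j, |y j - x j| < ε) → y ∈ c i := by
  obtain ⟨δ, hδ, h⟩ := lebesgue_number_lemma_of_metric hK hc hKc
  refine ⟨δ / (n + 1), by positivity, fun x hx => (h x hx).imp fun i hi y hy => hi ?_⟩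
  rw [Metric.mem_ball, EuclideanSpace.dist_eq, Real.sqrt_lt' hδ]
  calc ∑ j, dist (y j) (x j) ^ 2 ≤ ∑ _j : Fin n, (δ / (n + 1)) ^ 2 :=
        Finset.sum_le_sum fun j _ => pow_le_pow_left₀ dist_nonneg (hy j).le 2
    _ = n / (n + 1) ^ 2 * δ ^ 2 := by simp; field_simp
    _ < δ ^ 2 := by
        refine mul_lt_of_lt_one_left (by positivity) ?_
        rw [div_lt_one (by positivity)]
        nlinarith [(Nat.cast_nonneg n : (0 : ℝ) ≤ n)]

/-! ### Comparison of the two topologies on a site of cartesian spaces -/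

section Abstract

variable {C : Type (u + 1)} [Category.{u} C]

/-- The properties of a category `C` of spaces, with underlying space functor `F`, class `P` of open
embeddings, and cartesian spaces `R n` with coordinates `coord n`, on which the comparison of the
two topologies rests. Both the topological and the smooth site have them. -/
structure IsCartesianSite (F : C ⥤ TopCat.{u}) (P : MorphismProperty C) (R : ℕ → C)
    (coord : ∀ n, F.obj (R n) → E n) : Prop where
  isOpen_range {X Y : C} {f : Y ⟶ X} (hf : P f) : IsOpen (range (F.map f))
  exists_lift {X Y U : C} (g : Y ⟶ X) {f : U ⟶ X} (hf : P f)
    (h : range (F.map g) ⊆ range (F.map f)) : ∃ k : Y ⟶ U, k ≫ f = g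
  exists_disjoint_cover (X : C) : ∃ (I : Type u) (n : I → ℕ) (f : ∀ i, R (n i) ⟶ X),
    IsDisjointOpenCover F P f
  isHomeomorph_coord (n : ℕ) : IsHomeomorph (coord n)
  exists_hom {m n : ℕ} {φ : E m → E n} (hφ : ContDiff ℝ ∞ φ) :
    ∃ f : R m ⟶ R n, ∀ x, coord n (F.map f x) = φ (coord m x)
  exists_intervals (c : ℝ) : ∃ (Y : C) (f : Y ⟶ R 1), P f ∧
    range (F.map f) = coord 1 ⁻¹' ⋃ i : ℤ, {v | v 0 ∈ Ioo (4 * i + c) (4 * i + c + 3)}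

theorem stdU_zero_eq : stdU 0 = ⋃ i : ℤ, {v | v 0 ∈ Ioo (4 * i + 0 : ℝ) (4 * i + 0 + 3)} := by
  simp only [stdU, add_zero]

theorem stdV_zero_eq : stdV 0 = ⋃ i : ℤ, {v | v 0 ∈ Ioo (4 * i + 2 : ℝ) (4 * i + 2 + 3)} := by
  have h (i : ℤ) : (4 * i + 5 : ℝ) = 4 * i + 2 + 3 := by ring
  simp only [stdV, h]

theorem stdU_union_stdV (n : ℕ) : stdU n ∪ stdV n = univ := by
  refine eq_univ_of_forall fun v => ?_
  have h₁ := Int.floor_le ((v 0 - 1) / 4)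
  have h₂ := Int.lt_floor_add_one ((v 0 - 1) / 4)
  set i := ⌊(v 0 - 1) / 4⌋
  -- `v 0` lies in `[4i+1, 4i+5)`, which `(4i, 4i+3)` and `(4i+2, 4i+5)` cover
  rcases lt_or_ge (v 0) (4 * i + 3) with h | h
  · exact Or.inl (mem_iUnion.2 ⟨i, by linarith, h⟩)
  · exact Or.inr (mem_iUnion.2 ⟨i, by linarith, by linarith⟩)

section OpenCovers

variable {F : C ⥤ TopCat.{u}} {P : MorphismProperty C} {R : ℕ → C}
  {coord : ∀ n, F.obj (R n) → E n}

theorem generators_le_openCoverTopology [P.IsMultiplicative]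
    (hloc : ∀ {X Y U : C} (g : Y ⟶ X) (f : U ⟶ X), P f → ∀ y : F.obj Y,
      F.map g y ∈ range (F.map f) →
        ∃ (W : C) (h : W ⟶ Y) (k : W ⟶ U), P h ∧ y ∈ range (F.map h) ∧ h ≫ g = k ≫ f) :
    (generators F P R coord).toGrothendieck ≤ openCoverTopology F P hloc := by
  rw [Precoverage.toGrothendieck_le_iff_le_toPrecoverage]
  rintro X S (⟨f, hf⟩ | ⟨n, f, hf, hU, hV⟩)
  · exact ⟨_, _, f, hf.1, fun i => Sieve.le_generate _ _ _ ⟨i⟩⟩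
  · refine (containsOpenCover_iff F P).2 fun x => ?_
    have hx : coord (n + 1) x ∈ stdU n ∪ stdV n := stdU_union_stdV n ▸ mem_univ _
    rcases hx with hx | hx
    · exact ⟨_, f 0, hf 0, Sieve.le_generate _ _ _ ⟨0⟩, hU ▸ hx⟩
    · exact ⟨_, f 1, hf 1, Sieve.le_generate _ _ _ ⟨1⟩, hV ▸ hx⟩

/-- Membership in the generated topology is local for disjoint open covers. -/
theorem mem_generated_of_disjoint {X : C} {I : Type u} {Y : I → C} {f : ∀ i, Y i ⟶ X}
    (hf : IsDisjointOpenCover F P f) {S : Sieve X}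
    (hS : ∀ i, S.pullback (f i) ∈ (generators F P R coord).toGrothendieck (Y i)) :
    S ∈ (generators F P R coord).toGrothendieck X := by
  refine GrothendieckTopology.transitive _
    (Precoverage.generate_mem_toGrothendieck (IsGenerator.disjoint f hf)) S ?_
  rintro Z _ ⟨W, k, _, ⟨i⟩, rfl⟩
  rw [Sieve.pullback_comp]
  exact GrothendieckTopology.pullback_stable _ k (hS i)

variable (coord) in
/-- The sieve of all morphisms to `X` after which the function `f : X → ℝ` takes its values in an
open interval of length `3`. -/
def intervalSieve {X : C} (f : X ⟶ R 1) : Sieve X where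
  arrows _ g := ∃ a : ℝ, ∀ y, coord 1 (F.map (g ≫ f) y) 0 ∈ Ioo a (a + 3)
  downward_closed := by
    rintro Y Z g ⟨a, ha⟩ k
    exact ⟨a, fun z => by simpa using ha (F.map k z)⟩

namespace IsCartesianSite

variable (H : IsCartesianSite F P R coord)
include H

theorem preconnectedSpace (n : ℕ) : PreconnectedSpace (F.obj (R n)) :=
  (H.isHomeomorph_coord n).homeomorph.symm.surjective.denseRange.preconnectedSpace
    (H.isHomeomorph_coord n).homeomorph.symm.continuous

/-- The generating cover `{U, V}` of the line, pulled back along `f`, localizes `f` to a disjoint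
union of intervals, and the components of the source localize it further to one of them. -/
theorem intervalSieve_mem {X : C} (f : X ⟶ R 1) :
    intervalSieve coord f ∈ (generators F P R coord).toGrothendieck X := by
  choose Y p hp hrange using fun i : Fin 2 => H.exists_intervals (![0, 2] i)
  have hgen := Precoverage.generate_mem_toGrothendieck (J := generators F P R coord)
    (IsGenerator.two 0 p hp (by rw [hrange, stdU_zero_eq]; rfl)
      (by rw [hrange, stdV_zero_eq]; rfl))
  refine GrothendieckTopology.transitive _
    (GrothendieckTopology.pullback_stable _ f hgen) _ ?_
  rintro Z g ⟨W, k, _, ⟨i⟩, hk⟩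
  obtain ⟨J, n, q, hq⟩ := H.exists_disjoint_cover Z
  refine mem_generated_of_disjoint hq fun j => ?_
  suffices (intervalSieve coord f).pullback g (q j) by
    rw [Sieve.pullback_eq_top_of_mem _ this]
    exact GrothendieckTopology.top_mem _ _
  have := H.preconnectedSpace (n j)
  let r : F.obj (R (n j)) → ℝ := fun y => coord 1 (F.map ((q j ≫ g) ≫ f) y) 0
  have hr : Continuous r := (EuclideanSpace.proj (𝕜 := ℝ) (0 : Fin 1)).continuous.comp
    ((H.isHomeomorph_coord 1).continuous.comp (F.map ((q j ≫ g) ≫ f)).hom.continuous)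
  obtain ⟨a, ha⟩ := exists_subset_Ioo_of_isPreconnected (isPreconnected_range hr) (![0, 2] i) (by
    rintro _ ⟨y, rfl⟩
    have hy : F.map ((q j ≫ g) ≫ f) y ∈ range (F.map (p i)) := by
      rw [Category.assoc, ← hk]
      exact ⟨F.map k (F.map (q j) y), by simp⟩
    rw [hrange] at hy
    simpa [r] using hy)
  exact ⟨a, fun y => ha ⟨y, rfl⟩⟩

/-- A sieve on `ℝⁿ` that contains an open cover is covering for the generated topology: the function
`‖x‖²` localizes to bounded sets, and there suitable multiples of the coordinates localize
to cubes that are contained in a member of the open cover. -/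
theorem mem_generated_of_containsOpenCover_space {n : ℕ} {S : Sieve (R n)}
    (hS : ContainsOpenCover F P S) : S ∈ (generators F P R coord).toGrothendieck (R n) := by
  obtain ⟨I, U, u, ⟨hu, hcov⟩, hSu⟩ := hS
  have hsurj := (H.isHomeomorph_coord n).surjective
  obtain ⟨ρ, hρ⟩ := H.exists_hom (φ := fun x : E n => EuclideanSpace.single (0 : Fin 1) (‖x‖ ^ 2))
    (contDiff_euclidean.2 fun i => by
      fin_cases i
      simpa using contDiff_norm_sq ℝ)
  refine GrothendieckTopology.transitive _ (H.intervalSieve_mem ρ) S ?_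
  rintro Z g ⟨a, ha⟩
  -- `‖x‖ ≤ ‖x‖² + 1` bounds the norm by `a + 4` where `‖x‖² < a + 3`
  have hbdd (z) : coord n (F.map g z) ∈ Metric.closedBall (0 : E n) (a + 4) := by
    have h := (ha z).2
    rw [Functor.map_comp, TopCat.comp_app, hρ] at h
    simp only [PiLp.single_apply, if_true] at h
    rw [mem_closedBall_zero_iff]
    nlinarith [sq_nonneg (‖coord n (F.map g z)‖ - 1)]
  obtain ⟨ε, hε, hcube⟩ := exists_cube_subset_of_isCompact (isCompact_closedBall (0 : E n) (a + 4))
    (c := fun i => coord n '' range (F.map (u i)))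
    (fun i => (H.isHomeomorph_coord n).isOpenMap _ (H.isOpen_range (hu i)))
    (by rw [← image_iUnion, hcov, image_univ, hsurj.range_eq]; exact subset_univ _)
  -- with the factor `3 / ε`, an interval of length `3` becomes one of length `ε`
  choose x hx using fun j : Fin n => H.exists_hom
    (φ := fun x : E n => EuclideanSpace.single (0 : Fin 1) (3 / ε * x j))
    (contDiff_euclidean.2 fun i => by
      fin_cases i
      simpa using contDiff_const.mul (contDiff_euclidean.1 contDiff_id j))
  have hinf : (Finset.univ.inf fun j => intervalSieve coord (x j)) ∈
      (generators F P R coord).toGrothendieck (R n) :=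
    Finset.inf_induction (p := (· ∈ (generators F P R coord).toGrothendieck (R n)))
      (GrothendieckTopology.top_mem _ _)
      (fun _ h₁ _ h₂ => GrothendieckTopology.intersection_covering _ h₁ h₂)
      fun j _ => H.intervalSieve_mem (x j)
  refine GrothendieckTopology.superset_covering _ ?_
    (GrothendieckTopology.pullback_stable _ g hinf)
  intro W h hh
  suffices ∃ i, range (F.map (h ≫ g)) ⊆ range (F.map (u i)) by
    obtain ⟨i, hi⟩ := this
    obtain ⟨k, hk⟩ := H.exists_lift _ (hu i) hi
    rw [Sieve.pullback_apply, ← hk]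
    exact S.downward_closed (hSu i) k
  rcases isEmpty_or_nonempty (F.obj W) with hW | ⟨⟨w₀⟩⟩
  · -- the empty space lies in any member of the cover, and there is one since `ℝⁿ` is nonempty
    obtain ⟨i, -⟩ := mem_iUnion.1 (hcov ▸ mem_univ (hsurj 0).choose)
    exact ⟨i, by rintro _ ⟨w, -⟩; exact hW.elim w⟩
  obtain ⟨i, hi⟩ := hcube _ (hbdd (F.map h w₀))
  refine ⟨i, ?_⟩
  rintro _ ⟨w, rfl⟩
  obtain ⟨z, hz, hzw⟩ := hi (coord n (F.map (h ≫ g) w)) fun j => by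
    obtain ⟨b, hb⟩ := Finset.inf_le (f := fun j => intervalSieve coord (x j))
      (Finset.mem_univ j) _ hh
    have hmem (w) : 3 / ε * coord n (F.map (h ≫ g) w) j ∈ Ioo b (b + 3) := by
      have := hb w
      rw [Functor.map_comp, TopCat.comp_app, hx] at this
      simpa using this
    have h₁ := hmem w
    have h₂ := hmem w₀
    rw [Functor.map_comp F h g, TopCat.comp_app] at h₂
    have h₃ : |3 / ε * (coord n (F.map (h ≫ g) w) j - coord n (F.map g (F.map h w₀)) j)| < 3 := by
      rw [abs_lt]
      constructor <;> linarith [h₁.1, h₁.2, h₂.1, h₂.2]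
    rw [abs_mul, abs_of_pos (by positivity), div_mul_eq_mul_div, div_lt_iff₀ hε] at h₃
    linarith
  exact (H.isHomeomorph_coord n).injective hzw ▸ hz

theorem generated_eq_openCoverTopology [P.IsMultiplicative]
    (hloc : ∀ {X Y U : C} (g : Y ⟶ X) (f : U ⟶ X), P f → ∀ y : F.obj Y,
      F.map g y ∈ range (F.map f) →
        ∃ (W : C) (h : W ⟶ Y) (k : W ⟶ U), P h ∧ y ∈ range (F.map h) ∧ h ≫ g = k ≫ f) :
    (generators F P R coord).toGrothendieck = openCoverTopology F P hloc := by
  refine le_antisymm (generators_le_openCoverTopology hloc) fun X S hS => ?_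
  obtain ⟨I, n, f, hf⟩ := H.exists_disjoint_cover X
  exact mem_generated_of_disjoint hf fun i => H.mem_generated_of_containsOpenCover_space
    ((openCoverTopology F P hloc).pullback_stable (f i) hS)

end IsCartesianSite
end OpenCovers
end Abstract

/-! ### Disjoint unions of intervals -/

/-- The midpoint of the interval `(4i + c, 4i + c + 3)`. -/
noncomputable def intervalCenter (c : ℝ) (i : ℤ) : E 1 :=
  EuclideanSpace.single 0 (4 * i + c + 3 / 2)

/-- The map from a disjoint union of lines to the line that sends the `i`-th summand
diffeomorphically onto the interval `(4i + c, 4i + c + 3)`. -/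
noncomputable def intervalsMap (c : ℝ) (p : Σ _ : ULift.{u} ℤ, E 1) : E 1 :=
  OpenPartialHomeomorph.univBall (intervalCenter c p.1.down) (3 / 2) p.2

theorem intervalsMap_mk (c : ℝ) (i : ULift.{u} ℤ) : (fun w => intervalsMap c ⟨i, w⟩) =
    OpenPartialHomeomorph.univBall (intervalCenter c i.down) (3 / 2) :=
  rfl

theorem range_up_comp {α β : Type*} (e : α → β) :
    range (fun x => (⟨e x⟩ : ULift.{u} β)) = ULift.down ⁻¹' range e := by
  ext ⟨v⟩
  simp

theorem range_univBall {n : ℕ} (v : E n) {r : ℝ} (hr : 0 < r) :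
    range (OpenPartialHomeomorph.univBall v r : E n → E n) = Metric.ball v r := by
  rw [← OpenPartialHomeomorph.univBall_target v hr,
    ← (OpenPartialHomeomorph.univBall v r).image_source_eq_target,
    OpenPartialHomeomorph.univBall_source, image_univ]

theorem range_intervalsMap_mk (c : ℝ) (i : ULift.{u} ℤ) :
    range (fun w => intervalsMap c ⟨i, w⟩) =
      {v | v 0 ∈ Ioo (4 * i.down + c) (4 * i.down + c + 3)} := by
  rw [intervalsMap_mk, range_univBall _ (by norm_num)]
  ext v
  rw [Metric.mem_ball, EuclideanSpace.dist_eq, Fin.sum_univ_one, Real.sqrt_sq dist_nonneg,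
    Real.dist_eq, abs_lt]
  simp only [intervalCenter, PiLp.single_apply, if_true, mem_ofPred_eq, mem_Ioo]
  constructor <;> rintro ⟨h₁, h₂⟩ <;> constructor <;> linarith

theorem range_intervalsMap (c : ℝ) : range (intervalsMap.{u} c) =
    ⋃ i : ℤ, {v | v 0 ∈ Ioo (4 * i + c : ℝ) (4 * i + c + 3)} := by
  rw [range_sigma_eq_iUnion_range]
  simp_rw [range_intervalsMap_mk]
  exact Equiv.ulift.surjective.iUnion_comp
    fun i : ℤ => {v : E 1 | v 0 ∈ Ioo (4 * i + c : ℝ) (4 * i + c + 3)}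

theorem isOpenEmbedding_intervalsMap (c : ℝ) : IsOpenEmbedding (intervalsMap.{u} c) := by
  have hb (i : ULift.{u} ℤ) : IsOpenEmbedding fun w => intervalsMap c ⟨i, w⟩ := by
    rw [intervalsMap_mk]
    exact OpenPartialHomeomorph.isOpenEmbedding _ (OpenPartialHomeomorph.univBall_source _ _)
  refine .of_continuous_injective_isOpenMap (continuous_sigma fun i => (hb i).continuous) ?_
    (isOpenMap_sigma.2 fun i => (hb i).isOpenMap)
  rintro ⟨i, v⟩ ⟨j, w⟩ h
  have hv : intervalsMap c ⟨i, v⟩ ∈ range fun w => intervalsMap c ⟨i, w⟩ := ⟨v, rfl⟩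
  have hw : intervalsMap c ⟨i, v⟩ ∈ range fun w => intervalsMap c ⟨j, w⟩ := ⟨w, h.symm⟩
  rw [range_intervalsMap_mk] at hv hw
  have h₁ : 4 * i.down < 4 * j.down + 3 := by
    exact_mod_cast (by linarith [hv.1, hw.2] : (4 * i.down : ℝ) < 4 * j.down + 3)
  have h₂ : 4 * j.down < 4 * i.down + 3 := by
    exact_mod_cast (by linarith [hw.1, hv.2] : (4 * j.down : ℝ) < 4 * i.down + 3)
  obtain rfl : i = j := ULift.down_injective (by omega)
  exact congrArg _ ((hb i).injective h)

/-! ### The topological site is cartesian -/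

namespace MCart

theorem isCartesianSite : IsCartesianSite isMCart.{u}.ι openEmb space
    fun n (v : EU.{u} n) => v.down where
  isOpen_range hf := hf.isOpen_range
  exists_lift {X Y U} g f hf h := by
    choose k hk using fun y => h (mem_range_self y)
    refine ⟨⟨TopCat.ofHom ⟨k, hf.isInducing.continuous_iff.2 ?_⟩⟩, ?_⟩
    · exact g.hom.hom.continuous.congr fun y => (hk y).symm
    · ext y
      exact hk y
  exists_disjoint_cover X := by
    obtain ⟨I, n, ⟨φ⟩⟩ := X.property
    let q (i : I) (w : EU.{u} (n i)) : X.obj := φ.symm ⟨i, w.down⟩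
    have hq (i : I) : IsOpenEmbedding (q i) := φ.symm.isOpenEmbedding.comp
      (IsOpenEmbedding.sigmaMk.comp Homeomorph.ulift.isOpenEmbedding)
    refine ⟨I, n, fun i => ⟨TopCat.ofHom (X := EU.{u} (n i)) ⟨q i, (hq i).continuous⟩⟩,
      ⟨hq, ?_⟩, ?_⟩
    · refine eq_univ_of_forall fun x => mem_iUnion.2 ⟨(φ x).1, ⟨(φ x).2⟩, ?_⟩
      exact φ.symm_apply_apply x
    · intro i j hij
      rw [disjoint_left]
      rintro _ ⟨v, rfl⟩ ⟨w, hw⟩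
      exact hij (congrArg Sigma.fst (φ.symm.injective hw)).symm
  isHomeomorph_coord n := Homeomorph.ulift.isHomeomorph
  exists_hom {m n φ} hφ := ⟨⟨TopCat.ofHom (X := EU.{u} m) (Y := EU.{u} n)
    ⟨fun v => ⟨φ v.down⟩, continuous_uliftUp.comp (hφ.continuous.comp continuous_uliftDown)⟩⟩,
    fun _ => rfl⟩
  exists_intervals c := by
    have h := Homeomorph.ulift.{u}.symm.isOpenEmbedding.comp (isOpenEmbedding_intervalsMap.{u} c)
    refine ⟨⟨TopCat.of (Σ _ : ULift.{u} ℤ, E 1), ULift ℤ, fun _ => 1, ⟨Homeomorph.refl _⟩⟩,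
      ⟨TopCat.ofHom (Y := EU.{u} 1) ⟨_, h.continuous⟩⟩, h, ?_⟩
    rw [← range_intervalsMap.{u}]
    exact range_up_comp _

end MCart

/-! ### The smooth site is cartesian -/

namespace SmoothManifold

/-- The smooth structure on a space `X` for which an open embedding `e` of `X` into `ℝⁿ` is a
chart. -/
noncomputable def ofOpenEmbedding {X : Type u} [TopologicalSpace X] [Nonempty X] {n : ℕ}
    {e : X → E n} (he : IsOpenEmbedding e) : SmoothManifold.{u} where
  carrier := X
  t2 := he.isEmbedding.t2Space
  paracompact :=
    have := he.isEmbedding.metrizableSpace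
    letI := TopologicalSpace.metrizableSpaceMetric X
    inferInstance
  atlas := {⟨n, he.toOpenPartialHomeomorph⟩}
  cover x := ⟨_, rfl, mem_univ x⟩
  compatible := by
    rintro _ rfl _ rfl
    refine contDiffOn_id.congr fun v hv => ?_
    exact he.toOpenPartialHomeomorph.right_inv hv.1

section OfOpenEmbedding

variable {X : Type u} [TopologicalSpace X] [Nonempty X] {n : ℕ} {e : X → E n}
  (he : IsOpenEmbedding e)

/-- The open embedding `e`, as a smooth map. -/
noncomputable def ofOpenEmbeddingHom : ofOpenEmbedding he ⟶ space.{u} n :=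
  Hom.mk (fun x => (⟨e x⟩ : EU.{u} n)) <| by
    refine ⟨(continuous_uliftUp.comp he.continuous).continuousOn, ?_⟩
    rintro _ rfl _ rfl
    refine contDiffOn_id.congr fun v hv => ?_
    exact he.toOpenPartialHomeomorph.right_inv hv.1

theorem openEmb_ofOpenEmbeddingHom : openEmb (ofOpenEmbeddingHom he) := by
  have h : IsOpenEmbedding (ofOpenEmbeddingHom he : Hom _ _).toFun :=
    Homeomorph.ulift.{u}.symm.isOpenEmbedding.comp he
  refine ⟨h, fun g hg => ⟨?_, ?_⟩⟩
  · rintro _ ⟨x, rfl⟩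
    refine ContinuousAt.continuousWithinAt (h.continuousAt_iff.1 ?_)
    exact continuousAt_id.congr (Filter.Eventually.of_forall fun x => (hg x).symm)
  · rintro _ rfl _ rfl
    refine contDiffOn_id.congr ?_
    rintro v ⟨-, ⟨x, hx⟩, -⟩
    obtain rfl : e x = v := congrArg ULift.down hx
    exact congrArg e (hg x)

/-- An open embedding `q` of `ℝⁿ` that the chart `e` turns into the embedding of a ball is a
diffeomorphism onto an open submanifold. -/
theorem exists_openEmb_to_ofOpenEmbedding {q : E n → X} {v : E n} {r : ℝ} (hr : 0 < r)
    (hq : IsOpenEmbedding q) (heq : ∀ w, e (q w) = OpenPartialHomeomorph.univBall v r w) :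
    ∃ f : space.{u} n ⟶ ofOpenEmbedding he, openEmb f ∧
      ∀ w, (f : Hom _ _).toFun w = q (w : EU.{u} n).down := by
  let b := OpenPartialHomeomorph.univBall v r
  have hQ : IsOpenEmbedding fun w : EU.{u} n => q w.down :=
    hq.comp Homeomorph.ulift.isOpenEmbedding
  refine ⟨Hom.mk (M := space n) (N := ofOpenEmbedding he) (fun w : EU.{u} n => q w.down)
    ⟨hQ.continuous.continuousOn, ?_⟩, ⟨hQ, fun g hg => ⟨?_, ?_⟩⟩, fun _ => rfl⟩
  · rintro _ rfl _ rfl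
    refine (OpenPartialHomeomorph.contDiff_univBall (c := v) (r := r)).contDiffOn.congr ?_
    exact fun w _ => heq w
  · rintro _ ⟨x, rfl⟩
    refine ContinuousAt.continuousWithinAt (hQ.continuousAt_iff.1 ?_)
    exact continuousAt_id.congr (Filter.Eventually.of_forall fun x => (hg x).symm)
  · rintro _ rfl _ rfl
    have hsub : ∀ p ∈ (he.toOpenPartialHomeomorph e).target ∩
        (he.toOpenPartialHomeomorph e).symm ⁻¹' (range fun w : EU.{u} n => q w.down),
        ∃ w : EU.{u} n, (he.toOpenPartialHomeomorph e).symm p = q w.down ∧ p = b w.down := by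
      rintro p ⟨hp, ⟨w, hw⟩⟩
      refine ⟨w, hw.symm, ?_⟩
      rw [← (he.toOpenPartialHomeomorph e).right_inv hp, ← hw]
      exact heq _
    refine (OpenPartialHomeomorph.contDiffOn_univBall_symm (c := v) (r := r)).congr_mono ?_ ?_
    · rintro p ⟨hp, hp', -⟩
      obtain ⟨w, hw, rfl⟩ := hsub p ⟨hp, hp'⟩
      refine (congrArg (fun x => (g x : EU.{u} n).down) hw).trans ?_
      refine (congrArg ULift.down (hg w)).trans ?_
      exact (b.left_inv (by simp [b])).symm
    · rintro p ⟨hp, hp', -⟩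
      obtain ⟨w, -, rfl⟩ := hsub p ⟨hp, hp'⟩
      rw [← range_univBall v hr]
      exact ⟨_, rfl⟩

end OfOpenEmbedding

theorem isSmoothMCart_ofOpenEmbedding_intervalsMap (c : ℝ) :
    isSmoothMCart (ofOpenEmbedding (isOpenEmbedding_intervalsMap.{u} c)) := by
  choose f hf hfq using fun i : ULift.{u} ℤ => exists_openEmb_to_ofOpenEmbedding
    (isOpenEmbedding_intervalsMap.{u} c) (v := intervalCenter c i.down) (r := 3 / 2) (by norm_num)
    (IsOpenEmbedding.sigmaMk (i := i)) (congrFun (intervalsMap_mk c i))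
  refine ⟨ULift ℤ, fun _ => 1, f, ⟨hf, ?_⟩, ?_⟩
  · exact eq_univ_of_forall fun x => mem_iUnion.2 ⟨x.1, ⟨x.2⟩, hfq _ _⟩
  · intro i j hij
    rw [disjoint_left]
    rintro _ ⟨v, rfl⟩ ⟨w, hw⟩
    exact hij (congrArg Sigma.fst ((hfq j w).symm.trans (hw.trans (hfq i v)))).symm

end SmoothManifold

namespace SmoothMCart

open SmoothManifold in
theorem isCartesianSite : IsCartesianSite forgetTop.{u} openEmb space
    fun n (v : EU.{u} n) => v.down where
  isOpen_range hf := hf.1.isOpen_range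
  exists_lift {X Y U} g f hf h := by
    let g' : Hom Y.obj X.obj := g.hom
    let f' : Hom U.obj X.obj := f.hom
    suffices ∃ k : Hom Y.obj U.obj, ∀ y, f'.toFun (k.toFun y) = g'.toFun y by
      obtain ⟨k, hk⟩ := this
      exact ⟨⟨k⟩, ObjectProperty.hom_ext _ (Hom.ext (funext hk))⟩
    rcases isEmpty_or_nonempty Y.obj.carrier with hY | ⟨⟨y₀⟩⟩
    · exact ⟨⟨hY.elim, fun x => hY.elim x, fun e _ e' _ p _ => hY.elim (e.2.symm p)⟩,
        fun y => hY.elim y⟩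
    obtain ⟨u₀, -⟩ := h (mem_range_self y₀)
    have : Nonempty (isSmoothMCart.ι.obj U).carrier := ⟨u₀⟩
    have hinv := Function.leftInverse_invFun hf.1.injective
    exact ⟨⟨_, (hf.2 _ hinv).comp g'.smooth fun y _ => h (mem_range_self y)⟩,
      fun y => Function.invFun_eq (h (mem_range_self y))⟩
  exists_disjoint_cover X := by
    obtain ⟨I, n, f, hf⟩ := X.property
    exact ⟨I, n, fun i => ⟨f i⟩, hf⟩
  isHomeomorph_coord n := Homeomorph.ulift.isHomeomorph
  exists_hom {m n φ} hφ := by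
    refine ⟨⟨Hom.mk (M := SmoothManifold.space m) (N := SmoothManifold.space n)
      (fun v : EU.{u} m => (⟨φ v.down⟩ : EU.{u} n)) ⟨?_, ?_⟩⟩, fun _ => rfl⟩
    · exact (continuous_uliftUp.comp (hφ.continuous.comp continuous_uliftDown)).continuousOn
    · rintro _ rfl _ rfl
      exact hφ.contDiffOn
  exists_intervals c := by
    refine ⟨⟨_, isSmoothMCart_ofOpenEmbedding_intervalsMap c⟩, ⟨ofOpenEmbeddingHom _⟩,
      openEmb_ofOpenEmbeddingHom _, ?_⟩
    rw [← range_intervalsMap.{u}]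
    exact range_up_comp _

end SmoothMCart

end CartSite

theorem mainTheorem4 :
    CartSite.MCart.generated.{u} = CartSite.MCart.openCovers.{u} ∧
      CartSite.SmoothMCart.generated.{u} = CartSite.SmoothMCart.openCovers.{u} :=
  ⟨CartSite.MCart.isCartesianSite.generated_eq_openCoverTopology CartSite.MCart.exists_local,
    CartSite.SmoothMCart.isCartesianSite.generated_eq_openCoverTopology
      CartSite.SmoothMCart.exists_local⟩
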